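/- Let $X$ be a complete $\mathrm{CAT}(1)$ space such that $d(v,v')<\pi/2$ for all $v,v'\in X$. Here a metric space is $\mathrm{CAT}(1)$ if any two points at distance less than $\pi$ are joined by a geodesic, and for every geodesic triangle of perimeter less than $2\pi$ the distance between any two of its points is at most the distance between their comparison points in a comparison triangle in the unit sphere $\mathbb{S}^2$. For $x,y\in X$ and $t\in[0,1]$, let $tx\oplus(1-t)y$ be the point $z$ of the unique geodesic segment $[x,y]$ with $d(x,z)=(1-t)d(x,y)$; a set $D\subseteq X$ is convex if $[x,y]\subseteq D$ for all $x,y\in D$; and for a nonempty closed convex set $D\subseteq X$ let $P_D x$ be the unique point of $D$ nearest to $x$. Let $C_1,\dots,C_r$ be closed convex subsets of $X$ such that $C:=\bigcap_{i=1}^r C_i\neq\emptyset$. Let $0<a<1/2$ and let $\alpha_{n,i}\in[a,1-a]$ for $n\in\mathbb{N}=\{1,2,\dots\}$ and $i=1,\dots,r$. For each $n$ let $W_n:X\to X$ be the $W$-mapping generated by $P_{C_1},\dots,P_{C_r}$ and $\alpha_{n,1},\dots,\alpha_{n,r}$, that is, $W_n:=U_{n,r}$, where $U_{n,0}x:=x$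 and $$U_{n,k}x:=\alpha_{n,k}P_{C_k}U_{n,k-1}x\oplus(1-\alpha_{n,k})x\qquad(x\in X,\ k=1,\dots,r).$$ Let $\{\beta_n\}$ be a sequence of real numbers with $0<\beta_n<1$ for every $n\in\mathbb{N}$, $\lim_{n\to\infty}\beta_n=0$ and $\sum_{n=1}^\infty\beta_n=\infty$. For given points $u,x_1\in X$, let $\{x_n\}$ be the sequence generated by $$x_{n+1}=\beta_n u\oplus(1-\beta_n)W_nx_n\qquad(n\in\mathbb{N}).$$ Suppose that one of the following conditions holds: (a) $\sup_{v,v'\in X}d(v,v')<\pi/2$; (b) $d(u,P_Cu)<\pi/4$ and $d(u,P_Cu)+d(x_1,P_Cu)<\pi/2$; (c) $\sum_{n=1}^\infty\beta_n^2=\infty$. Then $\{x_n\}$ converges to $P_Cu$. -/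

import Mathlib

/-- A geodesic from `x` to `y`: a curve `c`, considered on `[0, dist x y]`, which starts at `x`,
ends at `y` and preserves distances. Values of `c` outside that interval are irrelevant. -/
structure IsGeodesic {X : Type*} [MetricSpace X] (x y : X) (c : ℝ → X) : Prop where
  left : c 0 = x
  right : c (dist x y) = y
  isometric : ∀ s ∈ Set.Icc 0 (dist x y), ∀ t ∈ Set.Icc 0 (dist x y), dist (c s) (c t) = |s - t|

/-- The unit sphere of Euclidean 3-space. -/
abbrev UnitSphere2 : Type := Metric.sphere (0 : EuclideanSpace ℝ (Fin 3)) 1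

/-- The spherical (great-circle) distance on the unit sphere. -/
noncomputable def sphDist (p q : UnitSphere2) : ℝ :=
  InnerProductGeometry.angle (p : EuclideanSpace ℝ (Fin 3)) (q : EuclideanSpace ℝ (Fin 3))

/-- `p` is the point of the spherical segment from `x` to `y` at distance `s` from `x`. -/
def IsSphPoint (x y p : UnitSphere2) (s : ℝ) : Prop :=
  sphDist x p = s ∧ sphDist p y = sphDist x y - s

/-- `CAT(1)` spaces. Points at distance less than `π` are joined by a geodesic, and every geodesic
triangle of perimeter less than `2π` is at most as thick as its comparison triangles in the unit
sphere. The vertices of the triangle are `v 0, v 1, v 2`, its sides are `c i`, from `v i` to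
`v (i + 1)` (indices modulo `3`), a comparison triangle is `w 0, w 1, w 2`, and `p', q'` are the
comparison points of the points `c i s` and `c j t` of the triangle. -/
structure IsCAT1 (X : Type*) [MetricSpace X] : Prop where
  exists_geodesic : ∀ x y : X, dist x y < Real.pi → ∃ c : ℝ → X, IsGeodesic x y c
  comparison : ∀ (v : Fin 3 → X) (c : Fin 3 → ℝ → X) (w : Fin 3 → UnitSphere2),
    dist (v 0) (v 1) + dist (v 1) (v 2) + dist (v 2) (v 0) < 2 * Real.pi →
    (∀ i, IsGeodesic (v i) (v (i + 1)) (c i)) →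
    (∀ i, sphDist (w i) (w (i + 1)) = dist (v i) (v (i + 1))) →
    ∀ (i j : Fin 3), ∀ s ∈ Set.Icc 0 (dist (v i) (v (i + 1))),
      ∀ t ∈ Set.Icc 0 (dist (v j) (v (j + 1))),
      ∀ p' q' : UnitSphere2, IsSphPoint (w i) (w (i + 1)) p' s →
        IsSphPoint (w j) (w (j + 1)) q' t →
        dist (c i s) (c j t) ≤ sphDist p' q'

open Classical in
/-- The point `t x ⊕ (1 - t) y` on a geodesic from `x` to `y`, at distance `(1 - t) d(x, y)`
from `x`. In a `CAT(1)` space the geodesic exists and is unique whenever `d(x, y) < π`;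
the value is `x` where there is no geodesic. -/
noncomputable def geoComb {X : Type*} [MetricSpace X] (t : ℝ) (x y : X) : X :=
  if h : ∃ c : ℝ → X, IsGeodesic x y c then h.choose ((1 - t) * dist x y) else x

/-- A set is (geodesically) convex if it contains every geodesic segment between its points. -/
def IsGeodConvex {X : Type*} [MetricSpace X] (C : Set X) : Prop :=
  ∀ x ∈ C, ∀ y ∈ C, ∀ c : ℝ → X, IsGeodesic x y c → ∀ s ∈ Set.Icc 0 (dist x y), c s ∈ C

open Classical in
/-- The metric projection onto `C`: the point of `C` nearest to `x`. It exists and is unique for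
a nonempty closed convex subset of a complete `CAT(1)` space with all distances below `π / 2`;
the value is `x` where there is no nearest point. -/
noncomputable def metricProj {X : Type*} [MetricSpace X] (C : Set X) (x : X) : X :=
  if h : ∃ y ∈ C, dist x y = Metric.infDist x C then h.choose else x

/-- The `W`-mapping generated by `T₁, …, T_r` and `α₁, …, α_r`: with `U₀ = I` and
`U_k = α_k T_k U_{k-1} ⊕ (1 - α_k) I`, it is `U_r`. -/
noncomputable def wMapping {X : Type*} [MetricSpace X] :
    {r : ℕ} → (Fin r → X → X) → (Fin r → ℝ) → X → X
  | 0, _, _ => id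
  | r + 1, T, α => fun x =>
      geoComb (α (Fin.last r))
        (T (Fin.last r) (wMapping (fun i : Fin r => T i.castSucc) (fun i => α i.castSucc) x)) x

/-! Everything rests on functions `F` that along each geodesic lie above the solution of `f'' + f =
0` with the same end values. CAT(1) comparison says exactly that `cos (dist p ·)` is such a function
(`isCosConcave_cos_dist`), and the class is stable under pointwise limits. Completeness gives
maximum points (`IsCosConcave.exists_isMaxOn`), and at a maximum point `q` one has `F y ≤ F q * cos
(dist q y)` (`IsCosConcave.le_mul_cos_dist`). For `F = cos (dist x ·)`, `q` is the nearest point to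
`x`. For `F = lim cos (dist (x j) ·)` along an ultrafilter, `q` is the asymptotic center, and the
same inequality gives semicontinuity of the distance to `u`.

Let `p` be the projection of `u` onto the intersection. The step towards `u` gives, for `a n = 1 -
cos (dist p (x n))`, a recursion `a (n + 1) ≤ (1 - γ n) * a n + γ n * b n`
(`exists_convexComb_of_sin_le`). Each of the three conditions makes `∑ γ n` diverge. By
`tendsto_zero_of_le_convexComb` it remains to bound `b` from above where `a` hardly decreases. There
the W-mapping brings the iterates hardly closer to `p`, so each layer moves them little and they
approach every `C i` (`tendsto_dist_wMapping`). Their asymptotic center then lies in the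
intersection, so in the limit they are no closer to `u` than `p` is
(`limit_cos_dist_le_of_tendsto_dist`), which excludes `b` staying above a positive constant. -/

/-! ### Spherical comparison triangles -/

/-- A point of the unit sphere given by coordinates. -/
noncomputable def spherePoint (a b c : ℝ) (h : a ^ 2 + b ^ 2 + c ^ 2 = 1) : UnitSphere2 :=
  ⟨!₂[a, b, c], by
    rw [mem_sphere_zero_iff_norm, EuclideanSpace.norm_eq, Real.sqrt_eq_one]
    simpa [Fin.sum_univ_three] using h⟩

lemma cos_sphDist_spherePoint {a b c a' b' c' : ℝ} (h : a ^ 2 + b ^ 2 + c ^ 2 = 1)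
    (h' : a' ^ 2 + b' ^ 2 + c' ^ 2 = 1) :
    Real.cos (sphDist (spherePoint a b c h) (spherePoint a' b' c' h')) =
      a * a' + b * b' + c * c' := by
  rw [sphDist, InnerProductGeometry.cos_angle, norm_eq_of_mem_sphere, norm_eq_of_mem_sphere]
  simp [spherePoint, PiLp.inner_apply, Fin.sum_univ_three]
  ring

lemma sphDist_eq_of_cos_eq {p q : UnitSphere2} {d : ℝ} (h0 : 0 ≤ d) (h1 : d ≤ Real.pi)
    (h : Real.cos (sphDist p q) = Real.cos d) : sphDist p q = d :=
  Real.injOn_cos ⟨InnerProductGeometry.angle_nonneg _ _, InnerProductGeometry.angle_le_pi _ _⟩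
    ⟨h0, h1⟩ h

lemma sphDist_self (p : UnitSphere2) : sphDist p p = 0 := by
  apply InnerProductGeometry.angle_self
  have := norm_eq_of_mem_sphere p
  intro h
  simp [h] at this

/-- Given the side lengths of a triangle in which all sides are shorter than `π / 2`, there are
a comparison triangle and, for each `s`, a comparison point on its first side, whose distance to
the opposite vertex is given by Stewart's formula. -/
lemma exists_comparison_triangle {c a b s : ℝ} (hc : 0 < c) (hc' : c < Real.pi / 2)
    (ha : 0 ≤ a) (ha' : a < Real.pi / 2) (hb : 0 ≤ b) (hb' : b < Real.pi / 2)
    (h1 : a ≤ b + c) (h2 : b ≤ a + c) (h3 : c ≤ a + b) (hs : s ∈ Set.Icc 0 c) :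
    ∃ w₀ w₁ w₂ p : UnitSphere2, sphDist w₀ w₁ = c ∧ sphDist w₁ w₂ = a ∧ sphDist w₂ w₀ = b ∧
      IsSphPoint w₀ w₁ p s ∧
      Real.cos (sphDist p w₂) * Real.sin c =
        Real.cos b * Real.sin (c - s) + Real.cos a * Real.sin s := by
  have hπ := Real.pi_pos
  have hsc : 0 < Real.sin c := Real.sin_pos_of_pos_of_lt_pi hc (by linarith)
  have hsb : 0 ≤ Real.sin b := Real.sin_nonneg_of_nonneg_of_le_pi hb (by linarith)
  -- Second coordinate of `w₂`, dictated by the spherical law of cosines once `w₀ = (1, 0, 0)` and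
  -- `w₁ = (cos c, sin c, 0)`. The triangle inequalities amount to `|g| ≤ sin b`, which leaves room
  -- for a real third coordinate.
  set g := (Real.cos a - Real.cos b * Real.cos c) / Real.sin c with hg
  have hgc : g * Real.sin c = Real.cos a - Real.cos b * Real.cos c := by
    rw [hg]; field_simp
  have hlow : Real.cos (b + c) ≤ Real.cos a :=
    Real.cos_le_cos_of_nonneg_of_le_pi ha (by linarith) h1
  have hupp : Real.cos a ≤ Real.cos (b - c) := by
    rw [← Real.cos_abs (b - c)]
    refine Real.cos_le_cos_of_nonneg_of_le_pi (abs_nonneg _) (by linarith) ?_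
    rw [abs_le]; constructor <;> linarith
  rw [Real.cos_add] at hlow
  rw [Real.cos_sub] at hupp
  have hgabs : |g| ≤ Real.sin b := by
    rw [abs_le]
    constructor
    · refine le_of_mul_le_mul_right ?_ hsc
      rw [hgc]; linarith
    · refine le_of_mul_le_mul_right ?_ hsc
      rw [hgc]; linarith
  have hg2 : 0 ≤ Real.sin b ^ 2 - g ^ 2 := by
    have := pow_le_pow_left₀ (abs_nonneg g) hgabs 2
    rw [sq_abs] at this
    linarith
  have e0 : (1 : ℝ) ^ 2 + 0 ^ 2 + 0 ^ 2 = 1 := by norm_num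
  have e1 (t : ℝ) : Real.cos t ^ 2 + Real.sin t ^ 2 + 0 ^ 2 = 1 := by
    rw [Real.cos_sq_add_sin_sq]; norm_num
  have e2 : Real.cos b ^ 2 + g ^ 2 + √(Real.sin b ^ 2 - g ^ 2) ^ 2 = 1 := by
    rw [Real.sq_sqrt hg2]
    linarith [Real.cos_sq_add_sin_sq b]
  refine ⟨spherePoint 1 0 0 e0, spherePoint _ _ _ (e1 c), spherePoint _ _ _ e2,
    spherePoint _ _ _ (e1 s), ?_, ?_, ?_, ⟨?_, ?_⟩, ?_⟩
  · refine sphDist_eq_of_cos_eq hc.le (by linarith) ?_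
    rw [cos_sphDist_spherePoint]; ring
  · refine sphDist_eq_of_cos_eq ha (by linarith) ?_
    rw [cos_sphDist_spherePoint]; linarith
  · refine sphDist_eq_of_cos_eq hb (by linarith) ?_
    rw [cos_sphDist_spherePoint]; ring
  · refine sphDist_eq_of_cos_eq hs.1 (by linarith [hs.2]) ?_
    rw [cos_sphDist_spherePoint]; ring
  · have : sphDist (spherePoint 1 0 0 e0) (spherePoint _ _ _ (e1 c)) = c := by
      refine sphDist_eq_of_cos_eq hc.le (by linarith) ?_
      rw [cos_sphDist_spherePoint]; ring
    rw [this]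
    refine sphDist_eq_of_cos_eq (by linarith [hs.2]) (by linarith [hs.1]) ?_
    rw [cos_sphDist_spherePoint, Real.cos_sub]; ring
  · rw [cos_sphDist_spherePoint, Real.sin_sub]
    linear_combination Real.sin s * hgc

/-! ### Cos-concavity of the cosine of the distance -/

section Geometry

variable {X : Type*} [MetricSpace X]

/-- A function whose restriction to each geodesic is a supersolution of `f'' + f = 0`, in
integrated form. -/
def IsCosConcave (F : X → ℝ) : Prop :=
  ∀ (x y : X) (c : ℝ → X), IsGeodesic x y c → ∀ s ∈ Set.Icc 0 (dist x y),
    F x * Real.sin (dist x y - s) + F y * Real.sin s ≤ F (c s) * Real.sin (dist x y)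

lemma exists_isGeodesic (hX : IsCAT1 X) (hd : ∀ v v' : X, dist v v' < Real.pi / 2) (x y : X) :
    ∃ c : ℝ → X, IsGeodesic x y c :=
  hX.exists_geodesic x y (by linarith [hd x y, Real.pi_pos])

/-- Stewart's formula is an equality in the comparison triangle. The comparison inequality shortens
the distance from `c s` to `p`, hence raises its cosine. -/
lemma isCosConcave_cos_dist (hX : IsCAT1 X) (hd : ∀ v v' : X, dist v v' < Real.pi / 2) (p : X) :
    IsCosConcave fun z => Real.cos (dist p z) := by
  intro x y c hc s hs
  rcases (dist_nonneg : 0 ≤ dist x y).eq_or_lt with h0 | h0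
  · have : s = 0 := le_antisymm (h0 ▸ hs.2) hs.1
    simp [← h0, this]
  obtain ⟨c₁, hc₁⟩ := exists_isGeodesic hX hd y p
  obtain ⟨c₂, hc₂⟩ := exists_isGeodesic hX hd p x
  obtain ⟨w₀, w₁, w₂, q, hw₀, hw₁, hw₂, hq, hcos⟩ := exists_comparison_triangle h0 (hd x y)
    dist_nonneg (hd y p) dist_nonneg (hd p x)
    (by rw [add_comm, dist_comm x y, dist_comm p x]; exact dist_triangle y x p)
    (by rw [dist_comm p x, add_comm]; exact dist_triangle x y p)
    (by rw [add_comm, dist_comm p x, dist_comm y p]; exact dist_triangle x p y) hs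
  -- The comparison is between the point at parameter `s` on side `0` and the initial point of side
  -- `2`, which is the vertex `p`.
  have key := hX.comparison ![x, y, p] ![c, c₁, c₂] ![w₀, w₁, w₂]
    (by
      have := hd x y; have := hd y p; have := hd p x
      simp only [Matrix.cons_val]
      linarith [Real.pi_pos])
    (by
      intro i
      fin_cases i
      · exact hc
      · exact hc₁
      · exact hc₂)
    (by
      intro i
      fin_cases i
      · exact hw₀
      · exact hw₁
      · exact hw₂)
    0 2 s hs 0 ⟨le_rfl, dist_nonneg⟩ q w₂ hq ⟨sphDist_self _, by simp⟩
  have key' : dist (c s) p ≤ sphDist q w₂ := by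
    have h2 : c₂ 0 = p := hc₂.left
    simpa [h2] using key
  have hle : Real.cos (sphDist q w₂) ≤ Real.cos (dist (c s) p) :=
    Real.cos_le_cos_of_nonneg_of_le_pi dist_nonneg (InnerProductGeometry.angle_le_pi _ _) key'
  have hsin : 0 ≤ Real.sin (dist x y) :=
    Real.sin_nonneg_of_nonneg_of_le_pi dist_nonneg (by linarith [hd x y, Real.pi_pos])
  have := mul_le_mul_of_nonneg_right hle hsin
  rw [hcos] at this
  rw [dist_comm y p, dist_comm (c s) p] at this
  exact this

end Geometry

/-! ### Maximum points of cos-concave functions, projections and geodesic combinations -/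

section CosConcave

open Filter Topology

variable {X : Type*} [MetricSpace X]

/-- Quantitative form of `1 - cos d ≥ 2 d² / π²`, used to turn nearly equal cosine values into small
distances. -/
lemma sq_le_of_le_mul_cos {M ε d : ℝ} (hM : 0 < M) (hd0 : 0 ≤ d) (hd : d ≤ Real.pi)
    (h : M - ε ≤ M * Real.cos d) : d ^ 2 ≤ Real.pi ^ 2 * ε / (2 * M) := by
  have h1 := Real.cos_le_one_sub_mul_cos_sq (x := d) (by rwa [abs_of_nonneg hd0])
  have hπ := Real.pi_pos
  have h2 : M * (2 / Real.pi ^ 2 * d ^ 2) ≤ ε := by nlinarith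
  rw [le_div_iff₀ (by positivity)]
  calc d ^ 2 * (2 * M) = Real.pi ^ 2 * (M * (2 / Real.pi ^ 2 * d ^ 2)) := by field_simp
    _ ≤ _ := by gcongr

lemma sin_dist_pos (hd : ∀ v v' : X, dist v v' < Real.pi / 2) {x y : X} (h : 0 < dist x y) :
    0 < Real.sin (dist x y) :=
  Real.sin_pos_of_pos_of_lt_pi h (by linarith [hd x y, Real.pi_pos])

lemma cos_dist_pos (hd : ∀ v v' : X, dist v v' < Real.pi / 2) (x y : X) :
    0 < Real.cos (dist x y) :=
  Real.cos_pos_of_mem_Ioo ⟨by linarith [Real.pi_pos, dist_nonneg (x := x) (y := y)], hd x y⟩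

/-- The values at the end points of a segment of length `d` are controlled by an upper bound
on the segment. -/
lemma IsCosConcave.add_le_of_forall_le (hX : IsCAT1 X)
    (hd : ∀ v v' : X, dist v v' < Real.pi / 2) {C : Set X} (hC : IsGeodConvex C) {F : X → ℝ}
    (hF : IsCosConcave F) {M : ℝ} (hM : ∀ z ∈ C, F z ≤ M) {x y : X} (hx : x ∈ C) (hy : y ∈ C) :
    F x + F y ≤ 2 * (M * Real.cos (dist x y / 2)) := by
  rcases (dist_nonneg : 0 ≤ dist x y).eq_or_lt with h0 | h0
  · rw [← h0]
    simp only [zero_div, Real.cos_zero]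
    linarith [hM x hx, hM y hy]
  obtain ⟨c, hc⟩ := exists_isGeodesic hX hd x y
  have hmem : dist x y / 2 ∈ Set.Icc 0 (dist x y) := ⟨by positivity, by linarith⟩
  have h1 := hF x y c hc _ hmem
  have hz := hM _ (hC x hx y hy c hc _ hmem)
  have hs : 0 < Real.sin (dist x y / 2) :=
    Real.sin_pos_of_pos_of_lt_pi (by positivity) (by linarith [hd x y, Real.pi_pos])
  have hcos : 0 < Real.cos (dist x y / 2) :=
    Real.cos_pos_of_mem_Ioo ⟨by linarith [Real.pi_pos], by linarith [hd x y, Real.pi_pos]⟩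
  have e : Real.sin (dist x y) = 2 * Real.sin (dist x y / 2) * Real.cos (dist x y / 2) := by
    rw [← Real.sin_two_mul]; ring_nf
  have e' : dist x y - dist x y / 2 = dist x y / 2 := by ring
  rw [e, e'] at h1
  have h2 : F x + F y ≤ 2 * (F (c (dist x y / 2)) * Real.cos (dist x y / 2)) :=
    le_of_mul_le_mul_right (by linarith) hs
  have := mul_le_mul_of_nonneg_right hz hcos.le
  linarith

/-- At a maximum point `q` of a cos-concave function on a convex set, the function is controlled
by the distance to `q`. -/
lemma IsCosConcave.le_mul_cos_dist (hX : IsCAT1 X)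
    (hd : ∀ v v' : X, dist v v' < Real.pi / 2) {C : Set X} (hC : IsGeodConvex C) {F : X → ℝ}
    (hF : IsCosConcave F) {q : X} (hq : q ∈ C) (hmax : ∀ z ∈ C, F z ≤ F q) {y : X} (hy : y ∈ C) :
    F y ≤ F q * Real.cos (dist q y) := by
  rcases (dist_nonneg : 0 ≤ dist q y).eq_or_lt with h0 | h0
  · rw [← h0]
    simpa using hmax y hy
  obtain ⟨c, hc⟩ := exists_isGeodesic hX hd q y
  have hsin := sin_dist_pos hd h0
  -- First-order condition at the maximum: bound `F (c s)` by `F q`, cancel the common factor `2 sin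
  -- (s / 2)`, and let `s` tend to `0`.
  have hev : ∀ᶠ s in 𝓝[>] (0 : ℝ),
      F y * Real.cos (s / 2) ≤ F q * Real.cos (dist q y - s / 2) := by
    filter_upwards [Ioo_mem_nhdsGT h0] with s hs
    have hmem : s ∈ Set.Icc 0 (dist q y) := ⟨hs.1.le, hs.2.le⟩
    have h1 := hF q y c hc s hmem
    have h2 := mul_le_mul_of_nonneg_right (hmax _ (hC q hq y hy c hc s hmem)) hsin.le
    have hs2 : 0 < Real.sin (s / 2) :=
      Real.sin_pos_of_pos_of_lt_pi (by linarith [hs.1])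
        (by linarith [hs.2, hd q y, Real.pi_pos])
    have e1 : Real.sin s = 2 * Real.sin (s / 2) * Real.cos (s / 2) := by
      rw [← Real.sin_two_mul]; ring_nf
    have e2 : Real.sin (dist q y) - Real.sin (dist q y - s) =
        2 * Real.sin (s / 2) * Real.cos (dist q y - s / 2) := by
      rw [Real.sin_sub_sin]; ring_nf
    refine le_of_mul_le_mul_left ?_ hs2
    have h3 : F y * Real.sin s ≤ F q * (Real.sin (dist q y) - Real.sin (dist q y - s)) := by
      linarith
    rw [e1, e2] at h3
    linarith
  have t1 : Tendsto (fun s : ℝ => F y * Real.cos (s / 2)) (𝓝[>] 0) (𝓝 (F y)) := by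
    have : Continuous fun s : ℝ => F y * Real.cos (s / 2) := by fun_prop
    simpa using (this.tendsto 0).mono_left nhdsWithin_le_nhds
  have t2 : Tendsto (fun s : ℝ => F q * Real.cos (dist q y - s / 2)) (𝓝[>] 0)
      (𝓝 (F q * Real.cos (dist q y))) := by
    have : Continuous fun s : ℝ => F q * Real.cos (dist q y - s / 2) := by fun_prop
    simpa using (this.tendsto 0).mono_left nhdsWithin_le_nhds
  exact le_of_tendsto_of_tendsto t1 t2 hev

/-- A continuous, bounded cos-concave function which is positive somewhere on a closed convex set
attains its maximum there. -/
lemma IsCosConcave.exists_isMaxOn [CompleteSpace X] (hX : IsCAT1 X)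
    (hd : ∀ v v' : X, dist v v' < Real.pi / 2) {C : Set X} (hCc : IsClosed C)
    (hC : IsGeodConvex C) {F : X → ℝ} (hF : IsCosConcave F) (hcont : Continuous F) {B : ℝ}
    (hB : ∀ z, F z ≤ B) {z₀ : X} (hz₀ : z₀ ∈ C) (hpos : 0 < F z₀) :
    ∃ q ∈ C, ∀ z ∈ C, F z ≤ F q := by
  have hbdd : BddAbove (F '' C) := ⟨B, by rintro _ ⟨z, -, rfl⟩; exact hB z⟩
  set M := sSup (F '' C) with hMdef
  have hle : ∀ z ∈ C, F z ≤ M := fun z hz => le_csSup hbdd ⟨z, hz, rfl⟩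
  have hM : 0 < M := hpos.trans_le (hle z₀ hz₀)
  have hex : ∀ n : ℕ, ∃ y ∈ C, M - 1 / ((n : ℝ) + 1) < F y := by
    intro n
    have hlt : M - 1 / ((n : ℝ) + 1) < M := sub_lt_self _ Nat.one_div_pos_of_nat
    obtain ⟨_, ⟨y, hy, rfl⟩, h⟩ := exists_lt_of_lt_csSup (Set.Nonempty.image F ⟨z₀, hz₀⟩) hlt
    exact ⟨y, hy, h⟩
  choose y hyC hy using hex
  -- A maximizing sequence is Cauchy: the value at the midpoint of two near-maximizers exceeds their
  -- mean by the factor `1 / cos (dist / 2)`, yet stays below `M`.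
  have hdist : ∀ N n, N ≤ n →
      dist (y n) (y N) ^ 2 ≤ (2 * Real.pi ^ 2 / M) * (1 / ((N : ℝ) + 1)) := by
    intro N n hn
    have h1 := hF.add_le_of_forall_le hX hd hC hle (hyC n) (hyC N)
    have h2 := hy n
    have h3 := hy N
    have h4 : 1 / ((n : ℝ) + 1) ≤ 1 / ((N : ℝ) + 1) := Nat.one_div_le_one_div hn
    have h5 := sq_le_of_le_mul_cos (ε := 1 / ((N : ℝ) + 1)) hM
      (d := dist (y n) (y N) / 2) (by positivity)
      (by linarith [hd (y n) (y N), Real.pi_pos]) (by linarith)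
    calc dist (y n) (y N) ^ 2 = 4 * (dist (y n) (y N) / 2) ^ 2 := by ring
      _ ≤ 4 * (Real.pi ^ 2 * (1 / ((N : ℝ) + 1)) / (2 * M)) := by gcongr
      _ = _ := by field_simp; ring
  have hcauchy : CauchySeq y := by
    rw [Metric.cauchySeq_iff']
    intro ε hε
    have ht : Tendsto (fun N : ℕ => (2 * Real.pi ^ 2 / M) * (1 / ((N : ℝ) + 1))) atTop (𝓝 0) := by
      have := (tendsto_one_div_add_atTop_nhds_zero_nat (𝕜 := ℝ)).const_mul (2 * Real.pi ^ 2 / M)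
      rwa [mul_zero] at this
    obtain ⟨N, hN⟩ := (ht.eventually_lt_const (show (0 : ℝ) < ε ^ 2 by positivity)).exists
    exact ⟨N, fun n hn => lt_of_pow_lt_pow_left₀ 2 hε.le ((hdist N n hn).trans_lt hN)⟩
  obtain ⟨q, hq⟩ := cauchySeq_tendsto_of_complete hcauchy
  refine ⟨q, hCc.mem_of_tendsto hq (Eventually.of_forall hyC), fun z hz => (hle z hz).trans ?_⟩
  have ht : Tendsto (fun n : ℕ => M - 1 / ((n : ℝ) + 1)) atTop (𝓝 M) := by
    simpa using tendsto_one_div_add_atTop_nhds_zero_nat.const_sub M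
  exact le_of_tendsto_of_tendsto' ht ((hcont.tendsto q).comp hq) fun n => (hy n).le

/-- A nearest point is a maximum point of `cos (dist x ·)`. The maximum inequality is then the
spherical Pythagorean inequality for an angle of at least `π / 2` at the projection. -/
lemma metricProj_spec [CompleteSpace X] (hX : IsCAT1 X)
    (hd : ∀ v v' : X, dist v v' < Real.pi / 2) {C : Set X} (hCc : IsClosed C)
    (hC : IsGeodConvex C) (hne : C.Nonempty) (x : X) :
    metricProj C x ∈ C ∧ ∀ y ∈ C, Real.cos (dist x y) ≤
      Real.cos (dist x (metricProj C x)) * Real.cos (dist (metricProj C x) y) := by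
  have hF := isCosConcave_cos_dist hX hd x
  have hmono : ∀ {y z : X}, Real.cos (dist x y) ≤ Real.cos (dist x z) ↔ dist x z ≤ dist x y := by
    intro y z
    refine Real.strictAntiOn_cos.le_iff_ge ?_ ?_ <;>
    exact ⟨dist_nonneg, by linarith [hd x y, hd x z, Real.pi_pos]⟩
  have hex : ∃ y ∈ C, dist x y = Metric.infDist x C := by
    obtain ⟨z₀, hz₀⟩ := hne
    obtain ⟨q, hq, hmax⟩ := hF.exists_isMaxOn hX hd hCc hC (by fun_prop)
      (fun z => Real.cos_le_one _) hz₀ (cos_dist_pos hd x z₀)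
    refine ⟨q, hq, le_antisymm ?_ (Metric.infDist_le_dist_of_mem hq)⟩
    exact (Metric.le_infDist ⟨q, hq⟩).2 fun z hz => hmono.1 (hmax z hz)
  have hdef : metricProj C x = hex.choose := dif_pos hex
  rw [hdef]
  refine ⟨hex.choose_spec.1, fun y hy => hF.le_mul_cos_dist hX hd hC hex.choose_spec.1 ?_ hy⟩
  intro z hz
  rw [hmono, hex.choose_spec.2]
  exact Metric.infDist_le_dist_of_mem hz

lemma geoComb_spec (hX : IsCAT1 X) (hd : ∀ v v' : X, dist v v' < Real.pi / 2) {t : ℝ}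
    (ht0 : 0 ≤ t) (ht1 : t ≤ 1) (x y : X) :
    dist (geoComb t x y) y = t * dist x y ∧ ∀ F : X → ℝ, IsCosConcave F →
      F x * Real.sin (t * dist x y) + F y * Real.sin ((1 - t) * dist x y) ≤
        F (geoComb t x y) * Real.sin (dist x y) := by
  have h := exists_isGeodesic hX hd x y
  have hdef : geoComb t x y = h.choose ((1 - t) * dist x y) := dif_pos h
  have hc := h.choose_spec
  have hmem : (1 - t) * dist x y ∈ Set.Icc 0 (dist x y) :=
    ⟨mul_nonneg (by linarith) dist_nonneg, mul_le_of_le_one_left dist_nonneg (by linarith)⟩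
  rw [hdef]
  constructor
  · have h1 := hc.isometric _ hmem _ (Set.right_mem_Icc.2 dist_nonneg)
    rw [hc.right] at h1
    rw [h1, abs_sub_comm, abs_of_nonneg (by linarith [hmem.2])]
    ring
  · intro F hF
    have h1 := hF x y _ hc _ hmem
    rwa [show dist x y - (1 - t) * dist x y = t * dist x y by ring] at h1

lemma IsGeodConvex.iInter {ι : Sort*} {C : ι → Set X} (h : ∀ i, IsGeodConvex (C i)) :
    IsGeodConvex (⋂ i, C i) := by
  intro x hx y hy c hc s hs
  rw [Set.mem_iInter] at *
  exact fun i => h i x (hx i) y (hy i) c hc s hs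

end CosConcave

/-! ### W-mappings: monotonicity and asymptotic regularity -/

section WMapping

open Filter Topology

lemma tendsto_zero_of_sq_le_mul {ι : Type*} {l : Filter ι} {f g : ι → ℝ} {K : ℝ}
    (hf : ∀ j, 0 ≤ f j) (h : ∀ j, f j ^ 2 ≤ K * g j) (hg : Tendsto g l (𝓝 0)) :
    Tendsto f l (𝓝 0) := by
  have h1 : Tendsto (fun j => √(K * g j)) l (𝓝 0) := by
    have := (Real.continuous_sqrt.tendsto (K * 0)).comp (hg.const_mul K)
    simpa [Function.comp_def] using this
  exact squeeze_zero hf (fun j => Real.le_sqrt_of_sq_le (h j)) h1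

variable {X : Type*} [MetricSpace X]

/-- Uses `sin (tD) + sin ((1 - t)D) = 2 sin (D / 2) cos ((1 / 2 - t)D)`. The excess of `cos ((1 / 2
- t)D)` over `cos (D / 2)` is the strict gain that drives asymptotic regularity. -/
lemma IsCosConcave.mul_cos_le_geoComb (hX : IsCAT1 X)
    (hd : ∀ v v' : X, dist v v' < Real.pi / 2) {F : X → ℝ} (hF : IsCosConcave F) {t : ℝ}
    (ht0 : 0 ≤ t) (ht1 : t ≤ 1) {x y : X} {m : ℝ} (hx : m ≤ F x) (hy : m ≤ F y) :
    m * Real.cos ((1 / 2 - t) * dist x y) ≤ F (geoComb t x y) * Real.cos (dist x y / 2) := by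
  obtain ⟨h1, h2⟩ := geoComb_spec hX hd ht0 ht1 x y
  rcases (dist_nonneg : 0 ≤ dist x y).eq_or_lt with h0 | h0
  · rw [← h0, mul_zero, dist_eq_zero] at h1
    rw [h1, ← h0]
    simpa using hy
  have h3 := h2 F hF
  have hs : 0 < Real.sin (dist x y / 2) :=
    Real.sin_pos_of_pos_of_lt_pi (by positivity) (by linarith [hd x y, Real.pi_pos])
  have e : Real.sin (dist x y) = 2 * Real.sin (dist x y / 2) * Real.cos (dist x y / 2) := by
    rw [← Real.sin_two_mul]; ring_nf
  have e' : Real.sin (t * dist x y) + Real.sin ((1 - t) * dist x y) =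
      2 * Real.sin (dist x y / 2) * Real.cos ((1 / 2 - t) * dist x y) := by
    rw [show t * dist x y = dist x y / 2 - (1 / 2 - t) * dist x y by ring,
      show (1 - t) * dist x y = dist x y / 2 + (1 / 2 - t) * dist x y by ring,
      Real.sin_sub, Real.sin_add]
    ring
  have hn1 : 0 ≤ Real.sin (t * dist x y) :=
    Real.sin_nonneg_of_nonneg_of_le_pi (by positivity) (by nlinarith [hd x y, Real.pi_pos])
  have hn2 : 0 ≤ Real.sin ((1 - t) * dist x y) :=
    Real.sin_nonneg_of_nonneg_of_le_pi (mul_nonneg (by linarith) h0.le)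
      (by nlinarith [hd x y, Real.pi_pos])
  have h4 := mul_le_mul_of_nonneg_right hx hn1
  have h5 := mul_le_mul_of_nonneg_right hy hn2
  have h6 : m * (Real.sin (t * dist x y) + Real.sin ((1 - t) * dist x y)) ≤
      F (geoComb t x y) * Real.sin (dist x y) := by linarith
  rw [e, e'] at h6
  exact le_of_mul_le_mul_left (by linarith) hs

lemma IsCosConcave.le_geoComb (hX : IsCAT1 X)
    (hd : ∀ v v' : X, dist v v' < Real.pi / 2) {F : X → ℝ} (hF : IsCosConcave F) {t : ℝ}
    (ht0 : 0 ≤ t) (ht1 : t ≤ 1) {x y : X} {m : ℝ} (hm : 0 ≤ m) (hx : m ≤ F x) (hy : m ≤ F y) :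
    m ≤ F (geoComb t x y) := by
  have h1 := hF.mul_cos_le_geoComb hX hd ht0 ht1 hx hy
  have hD := hd x y
  have hD0 : 0 ≤ dist x y := dist_nonneg
  have hcos : 0 < Real.cos (dist x y / 2) :=
    Real.cos_pos_of_mem_Ioo ⟨by linarith [Real.pi_pos], by linarith [Real.pi_pos]⟩
  have h2 : Real.cos (dist x y / 2) ≤ Real.cos ((1 / 2 - t) * dist x y) := by
    rw [← Real.cos_abs ((1 / 2 - t) * dist x y)]
    refine Real.cos_le_cos_of_nonneg_of_le_pi (abs_nonneg _) (by linarith) ?_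
    rw [abs_le]
    constructor <;> nlinarith
  exact le_of_mul_le_mul_right ((mul_le_mul_of_nonneg_left h2 hm).trans h1) hcos

lemma cos_dist_le_cos_dist_metricProj [CompleteSpace X] (hX : IsCAT1 X)
    (hd : ∀ v v' : X, dist v v' < Real.pi / 2) {C : Set X} (hCc : IsClosed C)
    (hC : IsGeodConvex C) {p : X} (hp : p ∈ C) (v : X) :
    Real.cos (dist p v) ≤
      Real.cos (dist v (metricProj C v)) * Real.cos (dist p (metricProj C v)) := by
  rw [dist_comm p v, dist_comm p]
  exact (metricProj_spec hX hd hCc hC ⟨p, hp⟩ v).2 p hp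

lemma cos_dist_le_cos_dist_metricProj' [CompleteSpace X] (hX : IsCAT1 X)
    (hd : ∀ v v' : X, dist v v' < Real.pi / 2) {C : Set X} (hCc : IsClosed C)
    (hC : IsGeodConvex C) {p : X} (hp : p ∈ C) (v : X) :
    Real.cos (dist p v) ≤ Real.cos (dist p (metricProj C v)) :=
  (cos_dist_le_cos_dist_metricProj hX hd hCc hC hp v).trans
    (mul_le_of_le_one_left (cos_dist_pos hd _ _).le (Real.cos_le_one _))

/-- Asymptotic regularity of one layer of the `W`-mapping. -/
lemma tendsto_dist_geoComb_metricProj [CompleteSpace X] (hX : IsCAT1 X)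
    (hd : ∀ v v' : X, dist v v' < Real.pi / 2) {C : Set X} (hCc : IsClosed C)
    (hC : IsGeodConvex C) {p : X} (hp : p ∈ C) {ι : Type*} {l : Filter ι} {a : ℝ} (ha : 0 < a)
    {α : ι → ℝ} (hα : ∀ j, α j ∈ Set.Icc a (1 - a)) {x v : ι → X} {κ : ℝ} (hκ : 0 < κ)
    (hx : ∀ j, κ ≤ Real.cos (dist p (x j)))
    (hv : ∀ j, Real.cos (dist p (x j)) ≤ Real.cos (dist p (v j)))
    (h : Tendsto (fun j => Real.cos (dist p (geoComb (α j) (metricProj C (v j)) (x j))) -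
      Real.cos (dist p (x j))) l (𝓝 0)) :
    Tendsto (fun j => dist (metricProj C (v j)) (x j)) l (𝓝 0) ∧
    Tendsto (fun j => Real.cos (dist p (v j)) - Real.cos (dist p (x j))) l (𝓝 0) := by
  have hπ := Real.pi_pos
  have hw : ∀ j, Real.cos (dist p (v j)) ≤ Real.cos (dist p (metricProj C (v j))) :=
    fun j => cos_dist_le_cos_dist_metricProj' hX hd hCc hC hp (v j)
  have h1 : Tendsto (fun j => dist (metricProj C (v j)) (x j)) l (𝓝 0) := by
    refine tendsto_zero_of_sq_le_mul (K := Real.pi ^ 2 / (2 * κ * a ^ 2))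
      (fun j => dist_nonneg) (fun j => ?_) h
    set D := dist (metricProj C (v j)) (x j) with hD
    have hD0 : 0 ≤ D := dist_nonneg
    have hD1 : D < Real.pi / 2 := hd _ _
    obtain ⟨hα0, hα1⟩ := hα j
    have hF := isCosConcave_cos_dist hX hd p
    have h2 := hF.mul_cos_le_geoComb hX hd (t := α j) (by linarith) (by linarith)
      ((hv j).trans (hw j)) (le_refl (Real.cos (dist p (x j))))
    have h2' := hF.le_geoComb hX hd (t := α j) (by linarith) (by linarith)
      (hκ.le.trans (hx j)) ((hv j).trans (hw j)) (le_refl (Real.cos (dist p (x j))))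
    simp only [← hD] at h2 h2'
    set c := Real.cos (dist p (x j))
    set c' := Real.cos (dist p (geoComb (α j) (metricProj C (v j)) (x j)))
    have e : Real.cos ((1 / 2 - α j) * D) - Real.cos (D / 2) =
        2 * (Real.sin ((1 - α j) * D / 2) * Real.sin (α j * D / 2)) := by
      rw [Real.cos_sub_cos,
        show ((1 / 2 - α j) * D - D / 2) / 2 = -(α j * D / 2) by ring, Real.sin_neg,
        show ((1 / 2 - α j) * D + D / 2) / 2 = (1 - α j) * D / 2 by ring]
      ring
    -- Both weights `α j` and `1 - α j` are at least `a`, so Jordan's inequality bounds both sine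
    -- factors below by multiples of `D`, and the gain is at least of order `D ^ 2`.
    have hsin : ∀ b, a ≤ b → b ≤ 1 → a * D / Real.pi ≤ Real.sin (b * D / 2) := by
      intro b hb hb1
      have hbD : a * D ≤ b * D := by gcongr
      have hbD1 : b * D ≤ D := mul_le_of_le_one_left hD0 hb1
      have haD : 0 ≤ a * D := by positivity
      have := Real.mul_le_sin (x := b * D / 2) (by linarith) (by linarith)
      refine le_trans ?_ this
      calc a * D / Real.pi ≤ b * D / Real.pi := by gcongr
        _ = 2 / Real.pi * (b * D / 2) := by ring
    have h4 : (a * D / Real.pi) * (a * D / Real.pi) ≤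
        Real.sin ((1 - α j) * D / 2) * Real.sin (α j * D / 2) := by
      have := hsin (1 - α j) (by linarith) (by linarith)
      have := hsin (α j) (by linarith) (by linarith)
      gcongr
      exact le_trans (by positivity) ‹a * D / Real.pi ≤ Real.sin ((1 - α j) * D / 2)›
    -- Subtracting `c * cos (D / 2)` from `h2` leaves `(c' - c) * cos (D / 2)` on the right. As `c ≤
    -- c'`, this is at most `c' - c`.
    have h5 : c * (Real.cos ((1 / 2 - α j) * D) - Real.cos (D / 2)) ≤ c' - c := by
      have := mul_le_mul_of_nonneg_left (Real.cos_le_one (D / 2)) (sub_nonneg.2 h2')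
      linarith
    rw [e] at h5
    have h6 : κ * (2 * ((a * D / Real.pi) * (a * D / Real.pi))) ≤ c' - c := by
      refine le_trans ?_ h5
      have hc : κ ≤ c := hx j
      exact mul_le_mul hc (by linarith) (by positivity) (hκ.le.trans hc)
    calc D ^ 2 = Real.pi ^ 2 / (2 * κ * a ^ 2) *
          (κ * (2 * ((a * D / Real.pi) * (a * D / Real.pi)))) := by field_simp
      _ ≤ _ := by gcongr
  refine ⟨h1, squeeze_zero (fun j => sub_nonneg.2 (hv j)) (fun j => ?_) h1⟩
  calc Real.cos (dist p (v j)) - Real.cos (dist p (x j))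
      ≤ |Real.cos (dist p (metricProj C (v j))) - Real.cos (dist p (x j))| :=
        le_trans (by linarith [hw j]) (le_abs_self _)
    _ ≤ |dist p (metricProj C (v j)) - dist p (x j)| := Real.abs_cos_sub_cos_le _ _
    _ ≤ dist (metricProj C (v j)) (x j) := by
        rw [dist_comm p, dist_comm p]; exact abs_dist_sub_le _ _ _

/-- Projections onto sets containing `p`, and combinations with `x`, never leave the ball about `p`
through `x`; induction on the layers. -/
lemma cos_dist_le_cos_dist_wMapping [CompleteSpace X] (hX : IsCAT1 X)
    (hd : ∀ v v' : X, dist v v' < Real.pi / 2) {p x : X} : ∀ {r : ℕ} {C : Fin r → Set X},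
    (∀ i, IsClosed (C i)) → (∀ i, IsGeodConvex (C i)) → (∀ i, p ∈ C i) → ∀ {α : Fin r → ℝ},
    (∀ i, α i ∈ Set.Icc 0 1) →
    Real.cos (dist p x) ≤ Real.cos (dist p (wMapping (fun i => metricProj (C i)) α x))
  | 0, _, _, _, _, _, _ => le_rfl
  | r + 1, C, hCc, hC, hp, α, hα => by
    have ih := cos_dist_le_cos_dist_wMapping (x := x) hX hd (C := fun i : Fin r => C i.castSucc)
      (fun i => hCc _) (fun i => hC _) (fun i => hp _) (α := fun i => α i.castSucc)
      (fun i => hα _)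
    exact (isCosConcave_cos_dist hX hd p).le_geoComb hX hd (hα _).1 (hα _).2
      (cos_dist_pos hd _ _).le
      (ih.trans (cos_dist_le_cos_dist_metricProj' hX hd (hCc _) (hC _) (hp _) _)) le_rfl

/-- Asymptotic regularity of `W`-mappings. -/
lemma tendsto_dist_wMapping [CompleteSpace X] (hX : IsCAT1 X)
    (hd : ∀ v v' : X, dist v v' < Real.pi / 2) {p : X} {ι : Type*} {l : Filter ι} {a : ℝ}
    (ha : 0 < a) {x : ι → X} {κ : ℝ} (hκ : 0 < κ) (hx : ∀ j, κ ≤ Real.cos (dist p (x j))) :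
    ∀ {r : ℕ} {C : Fin r → Set X}, (∀ i, IsClosed (C i)) → (∀ i, IsGeodConvex (C i)) →
    (∀ i, p ∈ C i) → ∀ {α : ι → Fin r → ℝ}, (∀ j i, α j i ∈ Set.Icc a (1 - a)) →
    Tendsto (fun j => Real.cos (dist p (wMapping (fun i => metricProj (C i)) (α j) (x j))) -
      Real.cos (dist p (x j))) l (𝓝 0) →
    Tendsto (fun j => dist (wMapping (fun i => metricProj (C i)) (α j) (x j)) (x j)) l (𝓝 0) ∧
    ∀ i, ∃ z : ι → X, (∀ j, z j ∈ C i) ∧ Tendsto (fun j => dist (z j) (x j)) l (𝓝 0)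
  | 0, _, _, _, _, _, _, _ => ⟨by simpa [wMapping] using tendsto_const_nhds, fun i => i.elim0⟩
  | r + 1, C, hCc, hC, hp, α, hα, h => by
    have hα' : ∀ j i, α j i ∈ Set.Icc 0 1 := fun j i =>
      ⟨ha.le.trans (hα j i).1, by linarith [(hα j i).2]⟩
    set v : ι → X := fun j =>
      wMapping (fun i : Fin r => metricProj (C i.castSucc)) (fun i => α j i.castSucc) (x j)
      with hvdef
    have hv : ∀ j, Real.cos (dist p (x j)) ≤ Real.cos (dist p (v j)) := fun j =>
      cos_dist_le_cos_dist_wMapping hX hd (C := fun i : Fin r => C i.castSucc)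
        (fun i => hCc _) (fun i => hC _) (fun i => hp _) (fun i => hα' _ _)
    obtain ⟨h1, h2⟩ := tendsto_dist_geoComb_metricProj hX hd (hCc (Fin.last r)) (hC _) (hp _) ha
      (fun j => hα j (Fin.last r)) hκ hx hv h
    -- The second conclusion `h2` for the outer layer is precisely the hypothesis for the inner
    -- W-mapping, so regularity descends layer by layer.
    obtain ⟨-, h3⟩ := tendsto_dist_wMapping hX hd ha hκ hx (C := fun i : Fin r => C i.castSucc)
      (fun i => hCc _) (fun i => hC _) (fun i => hp _) (α := fun j i => α j i.castSucc)
      (fun j i => hα _ _) h2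
    refine ⟨squeeze_zero (fun j => dist_nonneg) (fun j => ?_) h1, fun i => ?_⟩
    · have := (geoComb_spec hX hd (hα' j (Fin.last r)).1 (hα' j (Fin.last r)).2
        (metricProj (C (Fin.last r)) (v j)) (x j)).1
      exact this.le.trans (mul_le_of_le_one_left dist_nonneg (hα' j (Fin.last r)).2)
    · induction i using Fin.lastCases with
      | last => exact ⟨_, fun j => (metricProj_spec hX hd (hCc _) (hC _) ⟨p, hp _⟩ _).1, h1⟩
      | cast i => exact h3 i

end WMapping

/-! ### Real recursions with weights of divergent sum -/

section RealSequences

open Filter Topology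

/-- A sequence with `a (n + 1) ≤ (1 - γ n) * a n + γ n * b n`, where `∑ γ n = ∞`, tends to zero as
soon as `b` is asymptotically nonpositive along the indices at which `a` does not decrease
substantially. -/
lemma tendsto_zero_of_le_convexComb {a γ b : ℕ → ℝ} (ha1 : ∀ n, a n ≤ 1) (ha0 : ∀ n, 0 ≤ a n)
    (hγ1 : ∀ n, γ n ≤ 1) (hγ : Tendsto γ atTop (𝓝 0))
    (hsum : Tendsto (fun N => ∑ n ∈ Finset.range N, γ n) atTop atTop)
    (h : ∀ n, a (n + 1) ≤ (1 - γ n) * a n + γ n * b n) (hγ0 : ∀ n, 0 ≤ γ n)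
    (hb : ∀ ε > 0, ∃ δ > 0, ∃ N, ∀ n ≥ N, a n - δ ≤ a (n + 1) → b n ≤ ε) :
    Tendsto a atTop (𝓝 0) := by
  have key : ∀ ε > 0, ∀ᶠ n in atTop, a n < 2 * ε := by
    intro ε hε
    obtain ⟨δ, hδ, N₀, hN₀⟩ := hb ε hε
    obtain ⟨N₁, hN₁⟩ := eventually_atTop.1 (hγ.eventually_lt_const hδ)
    set N := max N₀ N₁ with hN
    -- The excess of `a` over `ε` shrinks by the factor `1 - γ ≤ exp (-γ)` at every step, so
    -- divergence of the sum kills it.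
    have hexp : ∀ m, max (a (N + m) - ε) 0 ≤
        Real.exp (-∑ k ∈ Finset.range m, γ (N + k)) := by
      intro m
      induction m with
      | zero => simpa using by linarith [ha1 N]
      | succ m ih =>
        rw [Finset.sum_range_succ, neg_add, Real.exp_add]
        have hstep : max (a (N + (m + 1)) - ε) 0 ≤
            max (a (N + m) - ε) 0 * (1 - γ (N + m)) := by
          set e := max (a (N + m) - ε) 0 with he
          have he0 : 0 ≤ e := le_max_right _ _
          have he1 : a (N + m) - ε ≤ e := le_max_left _ _
          have he2 : e ≤ 1 := max_le (by linarith [ha1 (N + m)]) zero_le_one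
          have g0 := hγ0 (N + m)
          have g1 := hγ1 (N + m)
          have hh : a (N + (m + 1)) ≤ (1 - γ (N + m)) * a (N + m) + γ (N + m) * b (N + m) :=
            h (N + m)
          refine max_le ?_ (mul_nonneg he0 (by linarith))
          by_cases hcase : a (N + m) - δ ≤ a (N + m + 1)
          · have h1 := hN₀ (N + m) (by omega) hcase
            have h2 := mul_le_mul_of_nonneg_left h1 g0
            have h3 := mul_le_mul_of_nonneg_right he1 (sub_nonneg.2 g1)
            linarith
          -- A drop by more than `δ` is even better: `γ < δ` and the excess is at most `1`, so the
          -- drop exceeds `γ * e`.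
          · have h1 := hN₁ (N + m) (by omega)
            have h2 : γ (N + m) * e ≤ γ (N + m) := mul_le_of_le_one_right g0 he2
            rw [add_assoc] at hcase
            linarith
        refine hstep.trans (mul_le_mul ih (Real.one_sub_le_exp_neg _) ?_ (Real.exp_pos _).le)
        linarith [hγ1 (N + m)]
    have hsum' : Tendsto (fun m => ∑ k ∈ Finset.range m, γ (N + k)) atTop atTop := by
      have h1 : Tendsto (fun m => ∑ n ∈ Finset.range (m + N), γ n) atTop atTop :=
        (tendsto_add_atTop_iff_nat N).2 hsum
      refine (tendsto_atTop_add_const_right atTop (-∑ n ∈ Finset.range N, γ n) h1).congr ?_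
      intro m
      rw [add_comm m N, Finset.sum_range_add]
      ring
    have hlim := Real.tendsto_exp_neg_atTop_nhds_zero.comp hsum'
    obtain ⟨m₀, hm₀⟩ := eventually_atTop.1 (hlim.eventually_lt_const hε)
    filter_upwards [eventually_ge_atTop (N + m₀)] with n hn
    have h1 := (le_max_left _ _).trans (hexp (n - N))
    have h2 := hm₀ (n - N) (by omega)
    rw [Nat.add_sub_cancel' (by omega)] at h1
    simp only [Function.comp_apply] at h2
    linarith
  rw [Metric.tendsto_nhds]
  intro ε hε
  filter_upwards [key (ε / 2) (by positivity)] with n hn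
  rw [Real.dist_eq, sub_zero, abs_of_nonneg (ha0 n)]
  linarith

/-- The defining inequality of a cos-concave function, rewritten as a convex combination. -/
lemma exists_convexComb_of_sin_le {β D A B E : ℝ} (hβ0 : 0 < β) (hβ1 : β < 1) (hD0 : 0 ≤ D)
    (hD1 : D < Real.pi / 2)
    (h : A * Real.sin (β * D) + B * Real.sin ((1 - β) * D) ≤ E * Real.sin D)
    (h0 : D = 0 → E = A ∧ E = B) :
    ∃ γ, 0 ≤ γ ∧ γ ≤ β ∧ 2 / Real.pi * (β * Real.cos ((1 - β / 2) * D)) ≤ γ ∧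
      γ * (A * Real.cos (β * D / 2) / Real.cos ((1 - β / 2) * D)) + (1 - γ) * B ≤ E := by
  have hπ := Real.pi_pos
  rcases hD0.eq_or_lt with hD | hD
  · obtain ⟨rfl, rfl⟩ := h0 hD.symm
    refine ⟨β, hβ0.le, le_rfl, ?_, ?_⟩
    · rw [← hD, mul_zero, Real.cos_zero, mul_one]
      refine mul_le_of_le_one_left hβ0.le ?_
      rw [div_le_one hπ]
      exact Real.two_le_pi
    · simp only [← hD, mul_zero, zero_div, Real.cos_zero, mul_one, div_one]
      linarith
  have hsin : 0 < Real.sin D := Real.sin_pos_of_pos_of_lt_pi hD (by linarith)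
  have hβD : β * D ≤ D := mul_le_of_le_one_left hD.le hβ1.le
  have hβD0 : 0 < β * D := by positivity
  have hcos : 0 < Real.cos ((1 - β / 2) * D) :=
    Real.cos_pos_of_mem_Ioo ⟨by linarith, by linarith⟩
  have e1 : Real.sin D - Real.sin ((1 - β) * D) =
      2 * Real.sin (β * D / 2) * Real.cos ((1 - β / 2) * D) := by
    rw [Real.sin_sub_sin]; ring_nf
  have e2 : Real.sin (β * D) = 2 * Real.sin (β * D / 2) * Real.cos (β * D / 2) := by
    rw [← Real.sin_two_mul]; ring_nf
  have e3 : 1 - Real.sin ((1 - β) * D) / Real.sin D =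
      2 * Real.sin (β * D / 2) * Real.cos ((1 - β / 2) * D) / Real.sin D := by
    rw [← e1]; field_simp
  have hsin2 : 2 / Real.pi * (β * D / 2) ≤ Real.sin (β * D / 2) :=
    Real.mul_le_sin (by linarith) (by linarith)
  have hlow : 2 / Real.pi * (β * Real.cos ((1 - β / 2) * D)) ≤
      1 - Real.sin ((1 - β) * D) / Real.sin D := by
    rw [e3, le_div_iff₀ hsin]
    calc 2 / Real.pi * (β * Real.cos ((1 - β / 2) * D)) * Real.sin D
        ≤ 2 / Real.pi * (β * Real.cos ((1 - β / 2) * D)) * D := by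
          gcongr; exact Real.sin_le hD.le
      _ = 2 * (2 / Real.pi * (β * D / 2)) * Real.cos ((1 - β / 2) * D) := by ring
      _ ≤ _ := by gcongr
  -- This choice makes `1 - γ` the exact coefficient of `B` after division by `sin D`; `γ ≤ β` is
  -- concavity of the sine.
  refine ⟨1 - Real.sin ((1 - β) * D) / Real.sin D, le_trans (by positivity) hlow, ?_, hlow, ?_⟩
  · have hconc := strictConcaveOn_sin_Icc.concaveOn.2
      (⟨hD.le, by linarith⟩ : D ∈ Set.Icc 0 Real.pi) ⟨le_rfl, hπ.le⟩
      (sub_nonneg.2 hβ1.le) hβ0.le (sub_add_cancel 1 β)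
    simp only [smul_eq_mul, mul_zero, add_zero, Real.sin_zero] at hconc
    have : 1 - β ≤ Real.sin ((1 - β) * D) / Real.sin D := by rwa [le_div_iff₀ hsin]
    linarith
  · rw [sub_sub_cancel, e3]
    have e4 : 2 * Real.sin (β * D / 2) * Real.cos ((1 - β / 2) * D) / Real.sin D *
        (A * Real.cos (β * D / 2) / Real.cos ((1 - β / 2) * D)) =
        A * Real.sin (β * D) / Real.sin D := by
      rw [e2]
      generalize Real.cos ((1 - β / 2) * D) = k at hcos
      field_simp
    rw [e4, div_mul_eq_mul_div, ← add_div, div_le_iff₀ hsin]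
    linarith

end RealSequences

/-! ### Asymptotic centers along an ultrafilter -/

section Center

open Filter Topology

variable {X : Type*} [MetricSpace X]

lemma abs_cos_dist_sub_cos_dist_le (x y z : X) :
    |Real.cos (dist x y) - Real.cos (dist x z)| ≤ dist y z := by
  refine (Real.abs_cos_sub_cos_le _ _).trans ?_
  rw [dist_comm x, dist_comm x]
  exact abs_dist_sub_le _ _ _

/-- Compactness of `[-1, 1]` supplies the limits for all `z` at once, without subsequences.
Cos-concavity and the Lipschitz bound are closed conditions, so they pass to `F`. -/
lemma exists_limit_cos_dist (hX : IsCAT1 X) (hd : ∀ v v' : X, dist v v' < Real.pi / 2)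
    {ι : Type*} (l : Ultrafilter ι) (x : ι → X) :
    ∃ F : X → ℝ, IsCosConcave F ∧ Continuous F ∧ (∀ z, F z ≤ 1) ∧
      ∀ z, Tendsto (fun j => Real.cos (dist (x j) z)) l (𝓝 (F z)) := by
  have hex : ∀ z, ∃ L, Tendsto (fun j => Real.cos (dist (x j) z)) l (𝓝 L) := by
    intro z
    obtain ⟨L, -, hL⟩ := (isCompact_Icc (a := (-1 : ℝ)) (b := 1)).ultrafilter_le_nhds'
      (l.map fun j => Real.cos (dist (x j) z))
      (Ultrafilter.mem_map.2 <| univ_mem' fun j => ⟨Real.neg_one_le_cos _, Real.cos_le_one _⟩)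
    exact ⟨L, hL⟩
  choose F hF using hex
  refine ⟨F, ?_, ?_, fun z => le_of_tendsto' (hF z) fun j => Real.cos_le_one _, hF⟩
  · intro y z c hc s hs
    exact le_of_tendsto_of_tendsto' (((hF y).mul_const _).add ((hF z).mul_const _))
      ((hF (c s)).mul_const _) fun j => isCosConcave_cos_dist hX hd (x j) y z c hc s hs
  · refine (LipschitzWith.of_dist_le_mul (K := 1) fun y z => ?_).continuous
    rw [NNReal.coe_one, one_mul, Real.dist_eq]
    exact le_of_tendsto' ((hF y).sub (hF z)).abs fun j => abs_cos_dist_sub_cos_dist_le _ _ _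

/-- Lower semicontinuity of the distance to `u` under asymptotic centers, combined with the fact
that the asymptotic center of a sequence approaching closed convex sets lies in all of them. -/
lemma limit_cos_dist_le_of_tendsto_dist [CompleteSpace X] (hX : IsCAT1 X)
    (hd : ∀ v v' : X, dist v v' < Real.pi / 2) {ι κ : Type*} (l : Ultrafilter ι) {x : ι → X}
    {C : κ → Set X} (hCc : ∀ i, IsClosed (C i)) (hC : ∀ i, IsGeodConvex (C i))
    (hz : ∀ i, ∃ z : ι → X, (∀ j, z j ∈ C i) ∧ Tendsto (fun j => dist (z j) (x j)) l (𝓝 0))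
    {u : X} {L m : ℝ} (hL : Tendsto (fun j => Real.cos (dist (x j) u)) l (𝓝 L)) (hL0 : 0 < L)
    (hm : ∀ q ∈ ⋂ i, C i, Real.cos (dist u q) ≤ m) : L ≤ m := by
  obtain ⟨F, hF, hcont, hF1, hlim⟩ := exists_limit_cos_dist hX hd l x
  have hFu : F u = L := tendsto_nhds_unique (hlim u) hL
  have hconv : IsGeodConvex (Set.univ : Set X) := fun _ _ _ _ _ _ _ _ => Set.mem_univ _
  obtain ⟨q, -, hq⟩ := hF.exists_isMaxOn hX hd isClosed_univ hconv hcont hF1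
    (Set.mem_univ u) (hFu.symm ▸ hL0)
  have hqu := hF.le_mul_cos_dist hX hd hconv (Set.mem_univ q) hq (Set.mem_univ u)
  have hFq : 0 < F q := (hFu.symm ▸ hL0).trans_le (hq u (Set.mem_univ u))
  have hqC : q ∈ ⋂ i, C i := by
    rw [Set.mem_iInter]
    intro i
    obtain ⟨z, hzC, hzx⟩ := hz i
    have hzlim : ∀ y, Tendsto (fun j => Real.cos (dist y (z j))) l (𝓝 (F y)) := by
      intro y
      have h1 : Tendsto (fun j => Real.cos (dist y (z j)) - Real.cos (dist (x j) y)) l (𝓝 0) := by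
        refine squeeze_zero_norm (fun j => ?_) hzx
        rw [Real.norm_eq_abs, dist_comm (x j)]
        exact abs_cos_dist_sub_cos_dist_le _ _ _
      simpa using h1.add (hlim y)
    have : (l : Filter ι).NeBot := l.neBot
    obtain ⟨j₀⟩ : Nonempty ι := this.nonempty
    obtain ⟨hP, hPle⟩ := metricProj_spec hX hd (hCc i) (hC i) ⟨z j₀, hzC j₀⟩ q
    -- The projection inequality at the points `z j` of `C i`, in the limit. Combined with
    -- maximality of `F q > 0`, it forces `q` to equal its projection.
    have h1 : F q ≤ Real.cos (dist q (metricProj (C i) q)) * F (metricProj (C i) q) :=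
      le_of_tendsto_of_tendsto' (hzlim q) ((hzlim _).const_mul _) fun j => hPle _ (hzC j)
    have h2 := mul_le_mul_of_nonneg_left (hq (metricProj (C i) q) (Set.mem_univ _))
      (cos_dist_pos hd q (metricProj (C i) q)).le
    have h3 : 1 ≤ Real.cos (dist q (metricProj (C i) q)) :=
      le_of_mul_le_mul_right (by linarith) hFq
    have h4 := sq_le_of_le_mul_cos (M := 1) (ε := 0) one_pos
      (dist_nonneg (x := q) (y := metricProj (C i) q))
      (by linarith [hd q (metricProj (C i) q), Real.pi_pos]) (by linarith)
    have h5 : dist q (metricProj (C i) q) = 0 := by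
      apply pow_eq_zero_iff two_ne_zero |>.1
      exact le_antisymm (by simpa using h4) (sq_nonneg _)
    rw [dist_eq_zero.1 h5]
    exact hP
  have h6 := hm q hqC
  rw [dist_comm] at h6
  rw [hFu] at hqu
  exact (hqu.trans (mul_le_of_le_one_left (cos_dist_pos hd _ _).le (hF1 q))).trans h6

end Center

/-! ### Divergence of the weights and the Halpern iteration -/

section Halpern

open Filter Topology

lemma tendsto_sum_atTop_of_mul_le {f g : ℕ → ℝ} {k : ℝ} (hk : 0 < k) (h : ∀ n, k * f n ≤ g n)
    (hf : Tendsto (fun N => ∑ n ∈ Finset.range N, f n) atTop atTop) :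
    Tendsto (fun N => ∑ n ∈ Finset.range N, g n) atTop atTop := by
  refine tendsto_atTop_mono (fun N => ?_) (hf.const_mul_atTop hk)
  rw [Finset.mul_sum]
  exact Finset.sum_le_sum fun n _ => h n

lemma tendsto_sum_mul_cos_of_le {β D : ℕ → ℝ} (hβ : ∀ n, 0 < β n ∧ β n < 1)
    (hβsum : Tendsto (fun N => ∑ n ∈ Finset.range N, β n) atTop atTop) (hD0 : ∀ n, 0 ≤ D n)
    {M : ℝ} (hM : M < Real.pi / 2) (hD : ∀ n, D n ≤ M) :
    Tendsto (fun N => ∑ n ∈ Finset.range N, β n * Real.cos ((1 - β n / 2) * D n)) atTop atTop := by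
  have hM0 : 0 ≤ M := (hD0 0).trans (hD 0)
  refine tendsto_sum_atTop_of_mul_le (k := Real.cos M)
    (Real.cos_pos_of_mem_Ioo ⟨by linarith [Real.pi_pos], hM⟩) (fun n => ?_) hβsum
  obtain ⟨h0, h1⟩ := hβ n
  rw [mul_comm]
  refine mul_le_mul_of_nonneg_left ?_ h0.le
  refine Real.cos_le_cos_of_nonneg_of_le_pi (mul_nonneg (by linarith) (hD0 n))
    (by linarith [Real.pi_pos]) ?_
  exact (mul_le_of_le_one_left (hD0 n) (by linarith)).trans (hD n)

/-- Even at `D = π / 2` the cosine equals `sin (π β / 4) ≥ β / 2`, so each term is at least `β ^ 2 /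
2`. -/
lemma tendsto_sum_mul_cos_of_tendsto_sum_sq {β D : ℕ → ℝ} (hβ : ∀ n, 0 < β n ∧ β n < 1)
    (hβsum : Tendsto (fun N => ∑ n ∈ Finset.range N, β n ^ 2) atTop atTop)
    (hD0 : ∀ n, 0 ≤ D n) (hD : ∀ n, D n ≤ Real.pi / 2) :
    Tendsto (fun N => ∑ n ∈ Finset.range N, β n * Real.cos ((1 - β n / 2) * D n)) atTop atTop := by
  refine tendsto_sum_atTop_of_mul_le (k := 1 / 2) (by norm_num) (fun n => ?_) hβsum
  obtain ⟨h0, h1⟩ := hβ n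
  have hπ := Real.pi_pos
  have h2 : Real.cos ((1 - β n / 2) * (Real.pi / 2)) ≤ Real.cos ((1 - β n / 2) * D n) := by
    refine Real.cos_le_cos_of_nonneg_of_le_pi (mul_nonneg (by linarith) (hD0 n)) ?_ ?_
    · nlinarith
    · exact mul_le_mul_of_nonneg_left (hD n) (by linarith)
  have h3 : β n / 2 ≤ Real.cos ((1 - β n / 2) * (Real.pi / 2)) := by
    rw [show (1 - β n / 2) * (Real.pi / 2) = Real.pi / 2 - Real.pi / 2 * (β n / 2) by ring,
      Real.cos_pi_div_two_sub]
    exact Real.le_sin_mul (by linarith) (by linarith)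
  calc 1 / 2 * β n ^ 2 = β n * (β n / 2) := by ring
    _ ≤ _ := mul_le_mul_of_nonneg_left (h3.trans h2) h0.le

variable {X : Type*} [MetricSpace X] [CompleteSpace X]

/-- Halpern iteration for `W`-mappings of metric projections, under the divergence condition
on the weights which is common to all the criteria. -/
lemma tendsto_halpern_wMapping (hX : IsCAT1 X) (hd : ∀ v v' : X, dist v v' < Real.pi / 2)
    {r : ℕ} {C : Fin r → Set X} (hCc : ∀ i, IsClosed (C i)) (hC : ∀ i, IsGeodConvex (C i))
    {a : ℝ} (ha : 0 < a) {α : ℕ → Fin r → ℝ} (hα : ∀ n i, α n i ∈ Set.Icc a (1 - a))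
    {β : ℕ → ℝ} (hβ : ∀ n, 0 < β n ∧ β n < 1) (hβlim : Tendsto β atTop (𝓝 0))
    {u p : X} {x y : ℕ → X}
    (hy : ∀ n, y n = wMapping (fun i => metricProj (C i)) (α n) (x n))
    (hx : ∀ n, x (n + 1) = geoComb (β n) u (y n))
    (hp : ∀ i, p ∈ C i) (hpmax : ∀ q ∈ ⋂ i, C i, Real.cos (dist u q) ≤ Real.cos (dist p u))
    {κ : ℝ} (hκ : 0 < κ) (hκx : ∀ n, κ ≤ Real.cos (dist p (x n)))
    (hsum : Tendsto (fun N => ∑ n ∈ Finset.range N,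
      β n * Real.cos ((1 - β n / 2) * dist u (y n))) atTop atTop) :
    Tendsto x atTop (𝓝 p) := by
  have hπ := Real.pi_pos
  have hF := isCosConcave_cos_dist hX hd p
  have hα' : ∀ n i, α n i ∈ Set.Icc (0 : ℝ) 1 := fun n i =>
    ⟨ha.le.trans (hα n i).1, by linarith [(hα n i).2]⟩
  have hxy : ∀ n, Real.cos (dist p (x n)) ≤ Real.cos (dist p (y n)) := fun n => by
    rw [hy]
    exact cos_dist_le_cos_dist_wMapping hX hd hCc hC hp (hα' n)
  set A := Real.cos (dist p u) with hA
  have hA0 : 0 < A := cos_dist_pos hd p u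
  have hstep : ∀ n, ∃ γ, 0 ≤ γ ∧ γ ≤ β n ∧
      2 / Real.pi * (β n * Real.cos ((1 - β n / 2) * dist u (y n))) ≤ γ ∧
      γ * (A * Real.cos (β n * dist u (y n) / 2) / Real.cos ((1 - β n / 2) * dist u (y n))) +
        (1 - γ) * Real.cos (dist p (y n)) ≤ Real.cos (dist p (x (n + 1))) := by
    intro n
    obtain ⟨h1, h2⟩ := geoComb_spec hX hd (hβ n).1.le (hβ n).2.le u (y n)
    rw [← hx] at h1 h2
    refine exists_convexComb_of_sin_le (hβ n).1 (hβ n).2 dist_nonneg (hd _ _) (h2 _ hF) ?_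
    intro h0
    rw [h0, mul_zero, dist_eq_zero] at h1
    rw [hA, h1, dist_eq_zero.1 h0]
    exact ⟨rfl, rfl⟩
  choose γ hγ0 hγβ hγlow hγ using hstep
  have hcosh : ∀ n, 0 < Real.cos ((1 - β n / 2) * dist u (y n)) := by
    intro n
    obtain ⟨h0, h1⟩ := hβ n
    have h2 := hd u (y n)
    have h3 : 0 ≤ dist u (y n) := dist_nonneg
    have h4 : (1 - β n / 2) * dist u (y n) ≤ dist u (y n) :=
      mul_le_of_le_one_left h3 (by linarith)
    have h5 : 0 ≤ (1 - β n / 2) * dist u (y n) := mul_nonneg (by linarith) h3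
    exact Real.cos_pos_of_mem_Ioo ⟨by linarith, by linarith⟩
  have hcosβ : ∀ n, 0 < Real.cos (β n * dist u (y n) / 2) := by
    intro n
    obtain ⟨h0, h1⟩ := hβ n
    have h2 := hd u (y n)
    have h3 : 0 ≤ dist u (y n) := dist_nonneg
    have h4 : β n * dist u (y n) ≤ dist u (y n) := mul_le_of_le_one_left h3 h1.le
    have h5 : 0 ≤ β n * dist u (y n) := by positivity
    exact Real.cos_pos_of_mem_Ioo ⟨by linarith, by linarith⟩
  set b : ℕ → ℝ := fun n =>
    1 - A * Real.cos (β n * dist u (y n) / 2) / Real.cos ((1 - β n / 2) * dist u (y n)) with hb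
  have hγ1 : ∀ n, γ n ≤ 1 := fun n => (hγβ n).trans (hβ n).2.le
  have hmain : Tendsto (fun n => 1 - Real.cos (dist p (x n))) atTop (𝓝 0) := by
    refine tendsto_zero_of_le_convexComb (γ := γ) (b := b)
      (fun n => by linarith [cos_dist_pos hd p (x n)])
      (fun n => by linarith [Real.cos_le_one (dist p (x n))]) hγ1
      (squeeze_zero hγ0 hγβ hβlim)
      (tendsto_sum_atTop_of_mul_le (by positivity) hγlow hsum) (fun n => ?_) hγ0 ?_
    · have h1 := hγ n
      have h2 := mul_le_mul_of_nonneg_left (hxy n) (sub_nonneg.2 (hγ1 n))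
      simp only [hb]
      linarith
    -- Failure yields indices `φ j ≥ j` at which `a` drops by less than `1 / (j + 1)` while `b`
    -- stays above a fixed `ε`.
    by_contra! hcon
    obtain ⟨ε, hε, hcon⟩ := hcon
    choose φ hφ hφδ hφb using fun j : ℕ =>
      hcon (1 / ((j : ℝ) + 1)) Nat.one_div_pos_of_nat j
    set l : Ultrafilter ℕ := hyperfilter ℕ
    have hl : (l : Filter ℕ) ≤ atTop := Nat.hyperfilter_le_atTop
    have hφlim : Tendsto φ l atTop := (tendsto_atTop_mono hφ tendsto_id).mono_left hl
    have hβφ : Tendsto (fun j => β (φ j)) l (𝓝 0) := hβlim.comp hφlim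
    have hdiff : Tendsto (fun j => Real.cos (dist p (y (φ j))) - Real.cos (dist p (x (φ j)))) l
        (𝓝 0) := by
      have h1 : Tendsto (fun j : ℕ => 1 / ((j : ℝ) + 1) + β (φ j)) l (𝓝 0) := by
        simpa only [add_zero] using (tendsto_one_div_add_atTop_nhds_zero_nat.mono_left hl).add hβφ
      refine squeeze_zero (fun j => sub_nonneg.2 (hxy _)) (fun j => ?_) h1
      have h2 := hφδ j
      have h3 := hγ (φ j)
      have h4 : 0 ≤ γ (φ j) * (A * Real.cos (β (φ j) * dist u (y (φ j)) / 2) /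
          Real.cos ((1 - β (φ j) / 2) * dist u (y (φ j)))) :=
        mul_nonneg (hγ0 _) (div_nonneg (mul_nonneg hA0.le (hcosβ _).le) (hcosh _).le)
      have h5 := mul_le_of_le_one_right (hγ0 (φ j)) (Real.cos_le_one (dist p (y (φ j))))
      have h6 := hγβ (φ j)
      linarith
    obtain ⟨hyx, hz⟩ := tendsto_dist_wMapping hX hd ha hκ (fun j => hκx (φ j)) hCc hC hp
      (α := fun j => α (φ j)) (fun j => hα (φ j)) (l := (l : Filter ℕ))
      (by simpa only [hy] using hdiff)
    simp only [← hy] at hyx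
    obtain ⟨F, -, -, -, hlim⟩ := exists_limit_cos_dist hX hd l fun j => x (φ j)
    have hβD : Tendsto (fun j => β (φ j) * dist u (y (φ j)) / 2) l (𝓝 0) := by
      refine squeeze_zero
        (fun j => div_nonneg (mul_nonneg (hβ _).1.le dist_nonneg) zero_le_two) (fun j => ?_) hβφ
      have h1 : dist u (y (φ j)) / 2 ≤ 1 := by linarith [hd u (y (φ j)), Real.pi_le_four]
      rw [mul_div_assoc]
      exact mul_le_of_le_one_right (hβ _).1.le h1
    have hlim1 : Tendsto (fun j => A * Real.cos (β (φ j) * dist u (y (φ j)) / 2)) l (𝓝 A) := by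
      have := ((Real.continuous_cos.tendsto 0).comp hβD).const_mul A
      simpa only [Real.cos_zero, mul_one, Function.comp_def] using this
    have hlim2 : Tendsto (fun j => Real.cos ((1 - β (φ j) / 2) * dist u (y (φ j)))) l
        (𝓝 (F u)) := by
      have h1 : Tendsto (fun j => Real.cos ((1 - β (φ j) / 2) * dist u (y (φ j))) -
          Real.cos (dist (x (φ j)) u)) l (𝓝 0) := by
        refine squeeze_zero_norm (fun j => ?_) (by simpa only [add_zero] using hβD.add hyx)
        rw [Real.norm_eq_abs]
        refine (abs_sub_le _ (Real.cos (dist u (y (φ j)))) _).trans (add_le_add ?_ ?_)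
        · refine (Real.abs_cos_sub_cos_le _ _).trans (le_of_eq ?_)
          rw [show (1 - β (φ j) / 2) * dist u (y (φ j)) - dist u (y (φ j)) =
            -(β (φ j) * dist u (y (φ j)) / 2) by ring, abs_neg, abs_of_nonneg]
          exact div_nonneg (mul_nonneg (hβ _).1.le dist_nonneg) zero_le_two
        · rw [dist_comm (x (φ j))]
          exact abs_cos_dist_sub_cos_dist_le _ _ _
      simpa using h1.add (hlim u)
    -- The limit of `b > ε`, cleared of its denominator. The case `F u = 0` contradicts `A > 0`;
    -- otherwise the asymptotic center gives `F u ≤ A`, a contradiction.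
    have hAF : A ≤ (1 - ε) * F u := by
      refine le_of_tendsto_of_tendsto' hlim1 (hlim2.const_mul _) fun j => ?_
      have h1 := hφb j
      simp only [hb] at h1
      rw [← div_le_iff₀ (hcosh _)]
      linarith
    have hF0 : 0 ≤ F u := ge_of_tendsto' (hlim u) fun j => (cos_dist_pos hd _ _).le
    rcases hF0.eq_or_lt with h0 | h0
    · rw [← h0, mul_zero] at hAF
      linarith
    · have := limit_cos_dist_le_of_tendsto_dist hX hd l hCc hC hz (hlim u) h0 hpmax
      have := mul_pos hε h0
      linarith
  rw [tendsto_iff_dist_tendsto_zero]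
  refine tendsto_zero_of_sq_le_mul (K := Real.pi ^ 2 / 2) (fun n => dist_nonneg) (fun n => ?_)
    hmain
  have := sq_le_of_le_mul_cos (M := 1) (ε := 1 - Real.cos (dist p (x n))) one_pos
    (dist_nonneg (x := p) (y := x n)) (by linarith [hd p (x n)]) (by linarith)
  rw [dist_comm]
  exact this.trans (le_of_eq (by ring))

end Halpern

/-! ### The main theorem -/

theorem theorem4p2 {X : Type*} [MetricSpace X] [CompleteSpace X] (hX : IsCAT1 X)
    (hdist : ∀ v v' : X, dist v v' < Real.pi / 2)
    (r : ℕ) (C : Fin r → Set X)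
    (hclosed : ∀ i, IsClosed (C i)) (hconvex : ∀ i, IsGeodConvex (C i))
    (hne : (⋂ i, C i).Nonempty)
    (a : ℝ) (ha : 0 < a) (ha' : a < 1 / 2)
    (α : ℕ → Fin r → ℝ) (hα : ∀ n i, α n i ∈ Set.Icc a (1 - a))
    (β : ℕ → ℝ) (hβ : ∀ n, 0 < β n ∧ β n < 1)
    (hβlim : Filter.Tendsto β Filter.atTop (nhds 0))
    (hβsum : Filter.Tendsto (fun N => ∑ n ∈ Finset.range N, β n) Filter.atTop Filter.atTop)
    (u : X) (x : ℕ → X)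
    (hx : ∀ n, x (n + 1) =
      geoComb (β n) u (wMapping (fun i => metricProj (C i)) (α n) (x n)))
    (hcond :
      Metric.diam (Set.univ : Set X) < Real.pi / 2 ∨
      (dist u (metricProj (⋂ i, C i) u) < Real.pi / 4 ∧
        dist u (metricProj (⋂ i, C i) u) + dist (x 0) (metricProj (⋂ i, C i) u) < Real.pi / 2) ∨
      Filter.Tendsto (fun N => ∑ n ∈ Finset.range N, (β n) ^ 2) Filter.atTop Filter.atTop) :
    Filter.Tendsto x Filter.atTop (nhds (metricProj (⋂ i, C i) u)) := by
  have hCc := isClosed_iInter hclosed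
  have hC := IsGeodConvex.iInter hconvex
  obtain ⟨hp, hpmax⟩ := metricProj_spec hX hdist hCc hC hne u
  set p := metricProj (⋂ i, C i) u
  have hp' : ∀ i, p ∈ C i := Set.mem_iInter.1 hp
  have hα' : ∀ n i, α n i ∈ Set.Icc (0 : ℝ) 1 := fun n i =>
    ⟨ha.le.trans (hα n i).1, by linarith [(hα n i).2]⟩
  set y : ℕ → X := fun n => wMapping (fun i => metricProj (C i)) (α n) (x n)
  -- The closed ball of radius `ρ` about `p` contains `u` and `x 0`, hence all iterates; `cos ρ` is
  -- the uniform lower bound `κ`.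
  set ρ := max (dist p u) (dist p (x 0)) with hρ
  have hρ0 : 0 ≤ ρ := dist_nonneg.trans (le_max_left _ _)
  have hρ1 : ρ < Real.pi / 2 := max_lt (hdist _ _) (hdist _ _)
  have hκ : 0 < Real.cos ρ := Real.cos_pos_of_mem_Ioo ⟨by linarith [Real.pi_pos], hρ1⟩
  have hcos : ∀ z, Real.cos ρ ≤ Real.cos (dist p z) ↔ dist p z ≤ ρ := fun z =>
    Real.strictAntiOn_cos.le_iff_ge ⟨hρ0, by linarith [Real.pi_pos]⟩
      ⟨dist_nonneg, by linarith [hdist p z, Real.pi_pos]⟩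
  have hxy : ∀ n, Real.cos (dist p (x n)) ≤ Real.cos (dist p (y n)) := fun n =>
    cos_dist_le_cos_dist_wMapping hX hdist hclosed hconvex hp' (hα' n)
  have hκx : ∀ n, Real.cos ρ ≤ Real.cos (dist p (x n)) := by
    intro n
    induction n with
    | zero => exact (hcos _).2 (le_max_right _ _)
    | succ n ih =>
      rw [hx n]
      exact (isCosConcave_cos_dist hX hdist p).le_geoComb hX hdist (hβ n).1.le (hβ n).2.le hκ.le
        ((hcos u).2 (le_max_left _ _)) (ih.trans (hxy n))
  refine tendsto_halpern_wMapping hX hdist hclosed hconvex ha hα hβ hβlim (y := y)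
    (fun n => rfl) hx hp' (fun q hq => ?_) hκ hκx ?_
  · rw [dist_comm p u]
    exact (hpmax q hq).trans (mul_le_of_le_one_right (cos_dist_pos hdist _ _).le
      (Real.cos_le_one _))
  rcases hcond with h | ⟨h1, h2⟩ | h
  · have hbdd : Bornology.IsBounded (Set.univ : Set X) :=
      Metric.isBounded_iff.2 ⟨Real.pi / 2, fun v _ v' _ => (hdist v v').le⟩
    exact tendsto_sum_mul_cos_of_le hβ hβsum (fun n => dist_nonneg) h fun n =>
      Metric.dist_le_diam_of_mem hbdd (Set.mem_univ _) (Set.mem_univ _)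
  -- The two halves of condition (b) cover the two possible values of `ρ`, and keep `dist u (y n)`
  -- uniformly below `π / 2`.
  · have hM : dist u p + ρ < Real.pi / 2 := by
      rw [hρ, dist_comm p u, dist_comm p]
      rcases max_cases (dist u p) (dist (x 0) p) with ⟨h, -⟩ | ⟨h, -⟩ <;> rw [h] <;> linarith
    refine tendsto_sum_mul_cos_of_le hβ hβsum (fun n => dist_nonneg) hM fun n => ?_
    exact (dist_triangle u p (y n)).trans
      (add_le_add le_rfl ((hcos _).1 ((hκx n).trans (hxy n))))
  · exact tendsto_sum_mul_cos_of_tendsto_sum_sq hβ h (fun n => dist_nonneg)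
      fun n => (hdist _ _).le
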